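/- Let $n \ge 2$ be an integer and $t \ge 2$ an even integer. A finite nonempty set $X$ of unit vectors in $\mathbb{R}^n$ (that is, $X \subset S^{n-1}$) is a harmonic index $t$-design if $\sum_{x\in X} f(x)=0$ for every harmonic homogeneous polynomial $f$ of degree $t$ on $\mathbb{R}^n$; put $I(X)=\{\langle x,y\rangle : x,y\in X,\ x\neq y\}$. Let $C_t^{\lambda}$ be the Gegenbauer polynomial, given by $(1-2xr+r^2)^{-\lambda}=\sum_{t\ge 0} C_t^{\lambda}(x)r^t$ for $\lambda\ne 0$, and $C_t^0=T_t$ the Chebyshev polynomial of the first kind. Let $Q_{n,t}$ be the multiple of $C_t^{(n-2)/2}$ with $Q_{n,t}(1)=\binom{n+t-1}{t}-\binom{n+t-3}{t-2}$, and put $$c_{n,t}=-\min_{-1\le x\le 1}Q_{n,t}(x),\qquad b_{n,t}=1+\frac{1}{c_{n,t}}\left\{\binom{n+t-1}{t}-\binom{n+t-3}{t-2}\right\}.$$ Suppose that $b_{n,t}$ is a natural number and that $X$ is a harmonic index $t$-design on $S^{n-1}$ with $|X|=b_{n,t}$. Then there is $\alpha\in[-1,1]$ such that $I(X)=\{\alpha,-\alpha\}$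 if $n\ge 3$, and $I(X)=\{\alpha\}$ if $n=2$. Moreover, the lines $\mathbb{R}x$ $(x\in X)$ are pairwise distinct for distinct points of $X$ and are equiangular, that is, any two distinct ones among them make the same angle. -/

import Mathlib

noncomputable section

namespace HarmonicIndex

/-- The Laplacian `∑ᵢ ∂²f/∂xᵢ²` of a real polynomial in `n` variables. -/
def laplacian {n : ℕ} (f : MvPolynomial (Fin n) ℝ) : MvPolynomial (Fin n) ℝ :=
  ∑ i : Fin n, MvPolynomial.pderiv i (MvPolynomial.pderiv i f)

/-- A finite nonempty subset `X` of the unit sphere of `ℝⁿ` such that `∑_{x ∈ X} f(x) = 0` for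
every harmonic homogeneous polynomial `f` of degree `t` on `ℝⁿ`. -/
def IsDesign (n t : ℕ) (X : Finset (EuclideanSpace ℝ (Fin n))) : Prop :=
  X.Nonempty ∧ (∀ x ∈ X, ‖x‖ = 1) ∧
    ∀ f : MvPolynomial (Fin n) ℝ, f.IsHomogeneous t → laplacian f = 0 →
      ∑ x ∈ X, MvPolynomial.eval (fun i => x i) f = 0

/-- The Gegenbauer polynomial `C_t^l`, as a function on `ℝ`. For `l ≠ 0` the value at `x` is the
`t`-th Taylor coefficient at `r = 0` of the generating function `(1 - 2xr + r²)^(-l)`;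
for `l = 0` it is the Chebyshev polynomial of the first kind. -/
def gegenbauer (l : ℝ) (t : ℕ) (x : ℝ) : ℝ :=
  if l = 0 then (Polynomial.Chebyshev.T ℝ (t : ℤ)).eval x
  else iteratedDeriv t (fun r : ℝ => (1 - 2 * x * r + r ^ 2) ^ (-l)) 0 / (t.factorial : ℝ)

/-- `(n+t-1 choose t) - (n+t-3 choose t-2)`; used only for `n ≥ 2` and `t ≥ 2`, where the
subtractions in `ℕ` are genuine. -/
def dimHarm (n t : ℕ) : ℝ :=
  ((n + t - 1).choose t : ℝ) - ((n + t - 3).choose (t - 2) : ℝ)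

/-- `Q_{n,t}`, the multiple of the Gegenbauer polynomial `C_t^{(n-2)/2}` whose value at `1` is
`(n+t-1 choose t) - (n+t-3 choose t-2)`. -/
def Q (n t : ℕ) (x : ℝ) : ℝ :=
  dimHarm n t / gegenbauer (((n : ℝ) - 2) / 2) t 1 * gegenbauer (((n : ℝ) - 2) / 2) t x

/-- `c_{n,t} = - min_{-1 ≤ x ≤ 1} Q_{n,t}(x)`. -/
def c (n t : ℕ) : ℝ := -sInf (Q n t '' Set.Icc (-1) 1)

/-- `b_{n,t} = 1 + (1 / c_{n,t}) ((n+t-1 choose t) - (n+t-3 choose t-2))`. -/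
def b (n t : ℕ) : ℝ := 1 + 1 / c n t * dimHarm n t

/-- `I(X)`, the set of inner products of two distinct points of `X`. -/
def innerProducts {n : ℕ} (X : Finset (EuclideanSpace ℝ (Fin n))) : Set ℝ :=
  {a | ∃ x ∈ X, ∃ y ∈ X, x ≠ y ∧ inner ℝ x y = a}

/-- The line through the origin and `x` (for `x ≠ 0`). -/
def line {n : ℕ} (x : EuclideanSpace ℝ (Fin n)) : Submodule ℝ (EuclideanSpace ℝ (Fin n)) :=
  Submodule.span ℝ {x}

/-- A set of lines through the origin, any two distinct of which make the same angle. The angle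
of two lines is the smaller of the angles `∠(u, v)` and `π - ∠(u, v)` of direction vectors. -/
def IsEquiangular {n : ℕ} (L : Set (Submodule ℝ (EuclideanSpace ℝ (Fin n)))) : Prop :=
  (∀ p ∈ L, Module.finrank ℝ p = 1) ∧
    ∃ θ : ℝ, ∀ p ∈ L, ∀ q ∈ L, p ≠ q → ∀ u ∈ p, ∀ v ∈ q, u ≠ 0 → v ≠ 0 →
      min (InnerProductGeometry.angle u v) (Real.pi - InnerProductGeometry.angle u v) = θ

end HarmonicIndex

end

namespace HarmonicIndex

/-! Summing the zonal harmonic with axis y ∈ X over the design gives Q(1) + ∑_{x ≠ y} Q(⟨x,y⟩) = 0.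
Each of the |X| - 1 off-diagonal terms is at least -c, and |X| = b says precisely that (|X| - 1)c =
Q(1). Hence every inner product of distinct points minimises Q on [-1,1] (`IsDesign.Q_inner_eq`). As
t is even, Q(-1) = Q(1) > 0, so -1 is not a minimiser and distinct points span distinct lines.

In the plane b = 2, so X is a pair and the rest is immediate. For n ≥ 3, Sonin's function shows that
the minimisers are determined up to sign (`gegenPoly_minimizer_abs_eq`), which gives equiangularity.

It remains to see that both signs occur. Otherwise all inner products equal one β ≠ 0, and the Gram
matrix is (1-β)I + βJ. Powers of isotropic complex linear forms are harmonic; taking the isotropic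
vector to be ∑ e_x x turns the design condition into the vanishing of a power sum on a quadric in
the coefficients. If the Gram matrix is invertible, three nonzero values already contradict this
(`exists_three_pow_ne_zero`). If it is singular, X is a regular simplex and four coefficients do
(`exists_four_pow_ne_zero`), provided t ≥ 4; for t = 2 the only minimiser is 0. -/

open MvPolynomial in
/-- The linear form `⟪v, ·⟫` as a polynomial. -/
noncomputable def linForm {n : ℕ} (v : EuclideanSpace ℝ (Fin n)) : MvPolynomial (Fin n) ℝ :=
  ∑ i, C (v i) * X i

open MvPolynomial in
/-- The polynomial `|x|²`. -/
noncomputable def normSqPoly (n : ℕ) : MvPolynomial (Fin n) ℝ := ∑ i, X i ^ 2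

open MvPolynomial in
theorem linForm_isHomogeneous {n : ℕ} (v : EuclideanSpace ℝ (Fin n)) :
    (linForm v).IsHomogeneous 1 := by
  apply IsHomogeneous.sum
  intro i _
  simpa using (isHomogeneous_C (Fin n) (v i)).mul (isHomogeneous_X ℝ i)

open MvPolynomial in
theorem normSqPoly_isHomogeneous (n : ℕ) : (normSqPoly n).IsHomogeneous 2 := by
  apply IsHomogeneous.sum
  intro i _
  simpa using (isHomogeneous_X ℝ i).pow 2

open MvPolynomial in
theorem pderiv_linForm {n : ℕ} (v : EuclideanSpace ℝ (Fin n)) (i : Fin n) :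
    pderiv i (linForm v) = C (v i) := by
  simp [linForm, pderiv_X, Pi.single_apply]

open MvPolynomial in
theorem pderiv_normSqPoly (n : ℕ) (i : Fin n) :
    pderiv i (normSqPoly n) = 2 * X i := by
  simp [normSqPoly, pderiv_X, Pi.single_apply]

open MvPolynomial in
theorem eval_linForm {n : ℕ} (v x : EuclideanSpace ℝ (Fin n)) :
    eval (fun i => x i) (linForm v) = inner ℝ x v := by
  simp [linForm, PiLp.inner_apply]

open MvPolynomial in
theorem eval_normSqPoly {n : ℕ} (x : EuclideanSpace ℝ (Fin n)) :
    eval (fun i => x i) (normSqPoly n) = ‖x‖ ^ 2 := by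
  simp [normSqPoly, EuclideanSpace.norm_sq_eq]

/-! ### Powers of isotropic linear forms -/

/-- Real and imaginary part of `(⟪v, ·⟫ + i ⟪w, ·⟫) ^ k` as real polynomials. -/
noncomputable def powPair {n : ℕ} (v w : EuclideanSpace ℝ (Fin n)) :
    ℕ → MvPolynomial (Fin n) ℝ × MvPolynomial (Fin n) ℝ
  | 0 => (1, 0)
  | k + 1 => (linForm v * (powPair v w k).1 - linForm w * (powPair v w k).2,
      linForm v * (powPair v w k).2 + linForm w * (powPair v w k).1)

theorem powPair_isHomogeneous {n : ℕ} (v w : EuclideanSpace ℝ (Fin n)) (k : ℕ) :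
    (powPair v w k).1.IsHomogeneous k ∧ (powPair v w k).2.IsHomogeneous k := by
  induction k with
  | zero => exact ⟨MvPolynomial.isHomogeneous_one _ _, MvPolynomial.isHomogeneous_zero _ _ _⟩
  | succ k ih =>
    have hv := linForm_isHomogeneous v
    have hw := linForm_isHomogeneous w
    rw [add_comm k 1]
    constructor
    · simpa [powPair, add_comm 1 k] using (hv.mul ih.1).sub (hw.mul ih.2)
    · simpa [powPair, add_comm 1 k] using (hv.mul ih.2).add (hw.mul ih.1)

open MvPolynomial in
theorem pderiv_powPair {n : ℕ} (v w : EuclideanSpace ℝ (Fin n)) (i : Fin n) (k : ℕ) :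
    pderiv i (powPair v w (k + 1)).1 =
        ((k : MvPolynomial (Fin n) ℝ) + 1) * (C (v i) * (powPair v w k).1 - C (w i) * (powPair v w k).2) ∧
      pderiv i (powPair v w (k + 1)).2 =
        ((k : MvPolynomial (Fin n) ℝ) + 1) * (C (v i) * (powPair v w k).2 + C (w i) * (powPair v w k).1) := by
  induction k with
  | zero => simp [powPair, pderiv_linForm]
  | succ k ih =>
    rw [powPair]
    simp only [map_sub, map_add, Derivation.leibniz, smul_eq_mul, pderiv_linForm, ih.1, ih.2]
    simp only [powPair]
    push_cast
    constructor <;> ring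

open MvPolynomial in
theorem sum_C_mul_C {n : ℕ} (v w : EuclideanSpace ℝ (Fin n)) :
    (∑ i, C (v i) * C (w i) : MvPolynomial (Fin n) ℝ) = C (inner ℝ v w) := by
  simp only [PiLp.inner_apply, map_sum, ← C_mul]
  exact Finset.sum_congr rfl fun i _ => by simp [mul_comm]

open MvPolynomial in
-- For L = ⟪v,·⟫ + i⟪w,·⟫ the Laplacian of L^k is k(k-1)(|v|² - |w|² + 2i⟨v,w⟩)L^(k-2), and the
-- hypotheses make the middle factor vanish.
theorem laplacian_powPair {n : ℕ} (v w : EuclideanSpace ℝ (Fin n)) (hvw : ‖v‖ = ‖w‖)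
    (h : inner ℝ v w = 0) (k : ℕ) :
    laplacian (powPair v w k).1 = 0 ∧ laplacian (powPair v w k).2 = 0 := by
  match k with
  | 0 => simp [laplacian, powPair]
  | 1 => simp [laplacian, powPair, pderiv_linForm]
  | k + 2 =>
    have h1 := sum_C_mul_C v v
    have h2 := sum_C_mul_C w w
    have h3 := sum_C_mul_C v w
    rw [real_inner_self_eq_norm_sq] at h1 h2
    rw [h, map_zero] at h3
    rw [← hvw, ← h1] at h2
    have hd : ∀ i, pderiv i ((k : MvPolynomial (Fin n) ℝ) + 1 + 1) = 0 := fun i => by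
      simp
    constructor
    · have : ∀ i, pderiv i (pderiv i (powPair v w (k + 2)).1) =
          ((k : MvPolynomial (Fin n) ℝ) + 2) * ((k : MvPolynomial (Fin n) ℝ) + 1) *
          ((C (v i) * C (v i) - C (w i) * C (w i)) * (powPair v w k).1 -
            2 * (C (v i) * C (w i)) * (powPair v w k).2) := fun i => by
        rw [(pderiv_powPair v w i (k + 1)).1]
        push_cast
        simp only [map_sub, Derivation.leibniz, smul_eq_mul, hd, pderiv_C,
          (pderiv_powPair v w i k).1, (pderiv_powPair v w i k).2]
        ring
      simp only [laplacian, this, ← Finset.mul_sum, ← Finset.sum_mul, Finset.sum_sub_distrib, h2, h3]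
      ring
    · have : ∀ i, pderiv i (pderiv i (powPair v w (k + 2)).2) =
          ((k : MvPolynomial (Fin n) ℝ) + 2) * ((k : MvPolynomial (Fin n) ℝ) + 1) *
          ((C (v i) * C (v i) - C (w i) * C (w i)) * (powPair v w k).2 +
            2 * (C (v i) * C (w i)) * (powPair v w k).1) := fun i => by
        rw [(pderiv_powPair v w i (k + 1)).2]
        push_cast
        simp only [map_add, Derivation.leibniz, smul_eq_mul, hd, pderiv_C,
          (pderiv_powPair v w i k).1, (pderiv_powPair v w i k).2]
        ring
      simp only [laplacian, this, ← Finset.mul_sum, ← Finset.sum_mul, Finset.sum_sub_distrib,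
        Finset.sum_add_distrib, h2, h3]
      ring

open MvPolynomial in
theorem eval_powPair {n : ℕ} (v w x : EuclideanSpace ℝ (Fin n)) (k : ℕ) :
    ((inner ℝ x v : ℝ) + (inner ℝ x w : ℝ) * Complex.I : ℂ) ^ k =
      (eval (fun i => x i) (powPair v w k).1 : ℝ) +
        (eval (fun i => x i) (powPair v w k).2 : ℝ) * Complex.I := by
  induction k with
  | zero => simp [powPair]
  | succ k ih =>
    rw [pow_succ, ih]
    simp only [powPair, map_sub, map_add, map_mul, eval_linForm]
    push_cast
    linear_combination (inner ℝ x w : ℂ) * (eval (fun i => x i) (powPair v w k).2 : ℝ) *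
      Complex.I_sq

/-- The powers of isotropic complex linear forms are harmonic, so they sum to zero on a design. -/
theorem IsDesign.sum_isotropic_pow {n t : ℕ} {X : Finset (EuclideanSpace ℝ (Fin n))}
    (hX : IsDesign n t X) (v w : EuclideanSpace ℝ (Fin n)) (hvw : ‖v‖ = ‖w‖)
    (h : inner ℝ v w = 0) :
    ∑ x ∈ X, ((inner ℝ x v : ℝ) + (inner ℝ x w : ℝ) * Complex.I : ℂ) ^ t = 0 := by
  have h1 := hX.2.2 _ (powPair_isHomogeneous v w t).1 (laplacian_powPair v w hvw h t).1
  have h2 := hX.2.2 _ (powPair_isHomogeneous v w t).2 (laplacian_powPair v w hvw h t).2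
  simp only [eval_powPair, Finset.sum_add_distrib, ← Finset.sum_mul]
  rw [← Complex.ofReal_sum, ← Complex.ofReal_sum, h1, h2]
  simp

/-! ### Zonal harmonics -/

/-- Zonal harmonics with axis `y`, by the three-term recurrence of the Gegenbauer polynomials. -/
noncomputable def zonal {n : ℕ} (l : ℝ) (y : EuclideanSpace ℝ (Fin n)) : ℕ → MvPolynomial (Fin n) ℝ
  | 0 => 1
  | 1 => MvPolynomial.C (2 * l) * linForm y
  | k + 2 => MvPolynomial.C (((k : ℝ) + 2)⁻¹) *
      (MvPolynomial.C (2 * (k + 1 + l)) * (linForm y * zonal l y (k + 1)) -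
        MvPolynomial.C (k + 2 * l) * (normSqPoly n * zonal l y k))

/-- Gegenbauer polynomials by their three-term recurrence. -/
noncomputable def gegenPoly (l : ℝ) : ℕ → Polynomial ℝ
  | 0 => 1
  | 1 => Polynomial.C (2 * l) * Polynomial.X
  | k + 2 => Polynomial.C (((k : ℝ) + 2)⁻¹) *
      (Polynomial.C (2 * (k + 1 + l)) * (Polynomial.X * gegenPoly l (k + 1)) -
        Polynomial.C (k + 2 * l) * gegenPoly l k)

theorem zonal_isHomogeneous {n : ℕ} (l : ℝ) (y : EuclideanSpace ℝ (Fin n)) (k : ℕ) :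
    (zonal l y k).IsHomogeneous k := by
  induction k using Nat.twoStepInduction with
  | zero => exact MvPolynomial.isHomogeneous_one _ _
  | one => exact (linForm_isHomogeneous y).C_mul _
  | more k h0 h1 =>
    refine MvPolynomial.IsHomogeneous.C_mul (MvPolynomial.IsHomogeneous.sub
      (MvPolynomial.IsHomogeneous.C_mul ?_ _) (MvPolynomial.IsHomogeneous.C_mul ?_ _)) _
    · have := (linForm_isHomogeneous y).mul h1
      rwa [show 1 + (k + 1) = k + 2 by ring] at this
    · have := (normSqPoly_isHomogeneous n).mul h0
      rwa [add_comm 2 k] at this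

theorem eval_zonal {n : ℕ} (l : ℝ) (x y : EuclideanSpace ℝ (Fin n)) (hx : ‖x‖ = 1) (k : ℕ) :
    MvPolynomial.eval (fun i => x i) (zonal l y k) = (gegenPoly l k).eval (inner ℝ x y) := by
  induction k using Nat.twoStepInduction with
  | zero => simp [zonal, gegenPoly]
  | one => simp [zonal, gegenPoly, eval_linForm]
  | more k h0 h1 =>
    simp only [zonal, gegenPoly, map_mul, map_sub, MvPolynomial.eval_C, eval_linForm,
      eval_normSqPoly, h0, h1, hx, Polynomial.eval_mul, Polynomial.eval_sub, Polynomial.eval_C,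
      Polynomial.eval_X]
    ring

open MvPolynomial in
theorem zonal_rec {n : ℕ} (l : ℝ) (y : EuclideanSpace ℝ (Fin n)) (k : ℕ) :
    C ((k : ℝ) + 2) * zonal l y (k + 2) = C (2 * (k + 1 + l)) * (linForm y * zonal l y (k + 1)) -
        C (k + 2 * l) * (normSqPoly n * zonal l y k) := by
  have : (k : ℝ) + 2 ≠ 0 := by positivity
  rw [zonal, ← mul_assoc, ← C_mul, mul_inv_cancel₀ this, C_1, one_mul]

open MvPolynomial in
/-- The derivative in the direction `y`. -/
noncomputable def dirDeriv {n : ℕ} (y : EuclideanSpace ℝ (Fin n)) :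
    Derivation ℝ (MvPolynomial (Fin n) ℝ) (MvPolynomial (Fin n) ℝ) :=
  ∑ i, y i • pderiv i

open MvPolynomial in
theorem dirDeriv_apply {n : ℕ} (y : EuclideanSpace ℝ (Fin n)) (f : MvPolynomial (Fin n) ℝ) :
    dirDeriv y f = ∑ i, C (y i) * pderiv i f := by
  simp only [dirDeriv, ← Derivation.coeFnAddMonoidHom_apply, map_sum, Finset.sum_apply]
  exact Finset.sum_congr rfl fun i _ => by simp [C_mul']

open MvPolynomial in
theorem dirDeriv_linForm {n : ℕ} (y : EuclideanSpace ℝ (Fin n)) (hy : ‖y‖ = 1) :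
    dirDeriv y (linForm y) = 1 := by
  simp only [dirDeriv_apply, pderiv_linForm, sum_C_mul_C, real_inner_self_eq_norm_sq, hy]
  simp

open MvPolynomial in
theorem dirDeriv_normSqPoly {n : ℕ} (y : EuclideanSpace ℝ (Fin n)) :
    dirDeriv y (normSqPoly n) = 2 * linForm y := by
  simp only [dirDeriv_apply, pderiv_normSqPoly, linForm, Finset.mul_sum]
  exact Finset.sum_congr rfl fun i _ => by ring

open MvPolynomial in
theorem dirDeriv_C {n : ℕ} (y : EuclideanSpace ℝ (Fin n)) (r : ℝ) : dirDeriv y (C r) = 0 := by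
  simp

open MvPolynomial in
-- Follows by differentiating the three-term recurrence along the axis. It evaluates the cross term
-- that the Laplacian of `linForm y * f` produces in `laplacian_zonal`.
theorem dirDeriv_zonal {n : ℕ} (l : ℝ) (y : EuclideanSpace ℝ (Fin n)) (hy : ‖y‖ = 1) (k : ℕ) :
    dirDeriv y (zonal l y (k + 1)) = C (k + 2 * l) * zonal l y k := by
  induction k using Nat.twoStepInduction with
  | zero => simp [zonal, dirDeriv_linForm y hy]
  | one =>
    have h := congrArg (dirDeriv y) (zonal_rec l y 0)
    rw [zonal, zonal] at h
    simp only [map_sub, dirDeriv_C, Derivation.leibniz, dirDeriv_linForm y hy,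
      dirDeriv_normSqPoly, smul_eq_mul, mul_zero, add_zero, mul_one, zero_add] at h
    have h2 : (C ((0 : ℕ) + 2 : ℝ) : MvPolynomial (Fin n) ℝ) ≠ 0 := by
      simp
    apply mul_left_cancel₀ h2
    refine h.trans ?_
    rw [zonal]
    simp only [map_mul, map_add, map_one, map_natCast, map_ofNat]
    push_cast
    ring
  | more k h0 h1 =>
    have h := congrArg (dirDeriv y) (zonal_rec l y (k + 1))
    have hr := zonal_rec l y k
    simp only [map_sub, dirDeriv_C, Derivation.leibniz, dirDeriv_linForm y hy,
      dirDeriv_normSqPoly, smul_eq_mul, mul_zero, add_zero, h0, h1] at h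
    have h2 : (C ((k + 1 : ℕ) + 2 : ℝ) : MvPolynomial (Fin n) ℝ) ≠ 0 := by
      rw [Ne, C_eq_zero]; positivity
    apply mul_left_cancel₀ h2
    refine h.trans ?_
    simp only [map_mul, map_add, map_one, map_natCast, map_ofNat] at hr ⊢
    push_cast
    linear_combination -(k + 1 + 2 * C l) * hr

open MvPolynomial in
theorem laplacian_sub {n : ℕ} (f g : MvPolynomial (Fin n) ℝ) :
    laplacian (f - g) = laplacian f - laplacian g := by
  simp [laplacian, Finset.sum_sub_distrib]

open MvPolynomial in
theorem laplacian_C_mul {n : ℕ} (r : ℝ) (f : MvPolynomial (Fin n) ℝ) :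
    laplacian (C r * f) = C r * laplacian f := by
  simp [laplacian, Finset.mul_sum]

open MvPolynomial in
theorem laplacian_linForm_mul {n : ℕ} (y : EuclideanSpace ℝ (Fin n))
    (f : MvPolynomial (Fin n) ℝ) :
    laplacian (linForm y * f) = 2 * dirDeriv y f + linForm y * laplacian f := by
  simp only [laplacian, dirDeriv_apply, Finset.mul_sum, ← Finset.sum_add_distrib]
  refine Finset.sum_congr rfl fun i _ => ?_
  simp only [Derivation.leibniz, smul_eq_mul, map_add, pderiv_linForm, pderiv_C]
  ring

open MvPolynomial in
theorem laplacian_normSqPoly_mul {n k : ℕ} (f : MvPolynomial (Fin n) ℝ) (hf : f.IsHomogeneous k) :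
    laplacian (normSqPoly n * f) = (2 * n + 4 * k) * f + normSqPoly n * laplacian f := by
  have he : ∑ i, X i * pderiv i f = k * f := by
    simpa using hf.sum_X_mul_pderiv
  have : ∀ i, pderiv i (pderiv i (normSqPoly n * f)) =
      2 * f + 4 * (X i * pderiv i f) + normSqPoly n * pderiv i (pderiv i f) := fun i => by
    have h2 : pderiv i (2 : MvPolynomial (Fin n) ℝ) = 0 := by
      simpa using (pderiv i).map_natCast 2
    simp only [Derivation.leibniz, smul_eq_mul, map_add, pderiv_normSqPoly, pderiv_X_self, h2]
    ring
  simp only [laplacian, this, Finset.sum_add_distrib, ← Finset.mul_sum, he]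
  simp
  ring

open MvPolynomial in
-- Applying the Laplacian to the recurrence leaves 4(k+1+l)(k+2l) - (k+2l)(2n+4k) times the harmonic
-- of degree k. This is zero because n = 2l + 2.
theorem laplacian_zonal {n : ℕ} (y : EuclideanSpace ℝ (Fin n)) (hy : ‖y‖ = 1) (k : ℕ) :
    laplacian (zonal (((n : ℝ) - 2) / 2) y k) = 0 := by
  obtain ⟨l, hl⟩ : ∃ l : ℝ, l = ((n : ℝ) - 2) / 2 := ⟨_, rfl⟩
  have hn : (n : MvPolynomial (Fin n) ℝ) = 2 * C l + 2 := by
    have : (n : ℝ) = 2 * l + 2 := by rw [hl]; ring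
    have := congrArg (C (σ := Fin n)) this
    simpa only [map_mul, map_add, map_natCast, map_ofNat] using this
  rw [← hl]
  induction k using Nat.twoStepInduction with
  | zero => simp [zonal, laplacian]
  | one => rw [zonal, laplacian_C_mul]; simp [laplacian, pderiv_linForm]
  | more k h0 h1 =>
    rw [zonal, laplacian_C_mul, laplacian_sub, laplacian_C_mul, laplacian_C_mul,
      laplacian_linForm_mul, laplacian_normSqPoly_mul _ (zonal_isHomogeneous l y k),
      dirDeriv_zonal l y hy, h0, h1, hn]
    apply mul_eq_zero_of_right
    simp only [map_mul, map_add, map_one, map_natCast, map_ofNat]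
    ring

theorem IsDesign.sum_gegenPoly {n t : ℕ} {X : Finset (EuclideanSpace ℝ (Fin n))}
    (hX : IsDesign n t X) (y : EuclideanSpace ℝ (Fin n)) (hy : ‖y‖ = 1) :
    ∑ x ∈ X, (gegenPoly (((n : ℝ) - 2) / 2) t).eval (inner ℝ x y) = 0 := by
  rw [← hX.2.2 _ (zonal_isHomogeneous (((n : ℝ) - 2) / 2) y t) (laplacian_zonal y hy t)]
  exact Finset.sum_congr rfl fun x hx => (eval_zonal _ x y (hX.2.1 x hx) t).symm

/-! ### From the generating function to the three-term recurrence -/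

theorem hasDerivAt_iteratedDeriv_of_analyticAt {f : ℝ → ℝ} {r : ℝ} (hf : AnalyticAt ℝ f r)
    (k : ℕ) : HasDerivAt (iteratedDeriv k f) (iteratedDeriv (k + 1) f r) r := by
  rw [iteratedDeriv_succ]
  apply DifferentiableAt.hasDerivAt
  rw [iteratedDeriv_eq_iterate]
  exact (hf.iterated_deriv k).differentiableAt

theorem generating_analyticAt (l x r : ℝ) (hr : 1 - 2 * x * r + r ^ 2 ≠ 0) :
    AnalyticAt ℝ (fun r : ℝ => (1 - 2 * x * r + r ^ 2) ^ (-l)) r := by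
  refine ContDiffAt.analyticAt (ContDiffAt.rpow_const_of_ne (ContDiff.contDiffAt ?_) hr)
  fun_prop

theorem hasDerivAt_one_sub_add_sq (x r : ℝ) :
    HasDerivAt (fun r : ℝ => 1 - 2 * x * r + r ^ 2) (-(2 * x) + 2 * r) r :=
  ((((hasDerivAt_id' r).const_mul (2 * x)).const_sub 1).add (hasDerivAt_pow 2 r)).congr_deriv
    (by simp)

theorem generating_deriv_eq (l x r : ℝ) (hr : 1 - 2 * x * r + r ^ 2 ≠ 0) :
    (1 - 2 * x * r + r ^ 2) *
        iteratedDeriv 1 (fun r : ℝ => (1 - 2 * x * r + r ^ 2) ^ (-l)) r =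
      2 * l * (x - r) * (1 - 2 * x * r + r ^ 2) ^ (-l) := by
  have h := hasDerivAt_one_sub_add_sq x r
  rw [iteratedDeriv_one, (h.rpow_const (p := -l) (Or.inl hr)).deriv, Real.rpow_sub_one hr]
  field_simp
  ring

/-- The equation (1 - 2xr + r²)F' = 2l(x - r)F differentiated k + 1 times. It is proved on the whole
open set of admissible r so that the induction can differentiate it again; only r = 0 is used later.
-/
theorem generating_iteratedDeriv_rec (l x : ℝ) (k : ℕ) :
    ∀ r : ℝ, 1 - 2 * x * r + r ^ 2 ≠ 0 →
      (1 - 2 * x * r + r ^ 2) *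
            iteratedDeriv (k + 2) (fun r : ℝ => (1 - 2 * x * r + r ^ 2) ^ (-l)) r =
        2 * (k + 1 + l) * (x - r) *
            iteratedDeriv (k + 1) (fun r : ℝ => (1 - 2 * x * r + r ^ 2) ^ (-l)) r -
          (k + 1) * (k + 2 * l) *
            iteratedDeriv k (fun r : ℝ => (1 - 2 * x * r + r ^ 2) ^ (-l)) r := by
  have hopen : IsOpen {r : ℝ | 1 - 2 * x * r + r ^ 2 ≠ 0} :=
    isOpen_ne_fun (by fun_prop) (by fun_prop)
  have hD := hasDerivAt_one_sub_add_sq x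
  have hF := fun (r : ℝ) (hr : 1 - 2 * x * r + r ^ 2 ≠ 0) (k : ℕ) =>
    hasDerivAt_iteratedDeriv_of_analyticAt (generating_analyticAt l x r hr) k
  have hx : ∀ (a r : ℝ), HasDerivAt (fun r : ℝ => a * (x - r)) (-a) r := fun a r => by
    simpa using ((hasDerivAt_id' r).const_sub x).const_mul a
  induction k with
  | zero =>
    intro r hr
    have h1 := (hD r).mul (hF r hr 1)
    have h2 := (hx (2 * l) r).mul (hF r hr 0)
    have h3 := h1.unique (h2.congr_of_eventuallyEq (Filter.eventuallyEq_of_mem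
      (hopen.mem_nhds hr) fun s hs => by
        simpa [iteratedDeriv_zero] using generating_deriv_eq l x s hs))
    push_cast
    linear_combination h3
  | succ k ih =>
    intro r hr
    have h1 := (hD r).mul (hF r hr (k + 2))
    have h2 := ((hx (2 * (k + 1 + l)) r).mul (hF r hr (k + 1))).sub
      ((hF r hr k).const_mul ((k + 1) * (k + 2 * l)))
    have h3 := h1.unique (h2.congr_of_eventuallyEq (Filter.eventuallyEq_of_mem
      (hopen.mem_nhds hr) fun s hs => ih s hs))
    push_cast
    linear_combination h3

theorem gegenPoly_rec (l : ℝ) (k : ℕ) (x : ℝ) :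
    (k + 2) * (gegenPoly l (k + 2)).eval x =
      2 * (k + 1 + l) * x * (gegenPoly l (k + 1)).eval x -
        (k + 2 * l) * (gegenPoly l k).eval x := by
  have : (k : ℝ) + 2 ≠ 0 := by positivity
  simp only [gegenPoly, Polynomial.eval_mul, Polynomial.eval_sub, Polynomial.eval_C,
    Polynomial.eval_X]
  field_simp

theorem iteratedDeriv_generating_zero (l x : ℝ) (k : ℕ) :
    iteratedDeriv k (fun r : ℝ => (1 - 2 * x * r + r ^ 2) ^ (-l)) 0 =
      k.factorial * (gegenPoly l k).eval x := by
  induction k using Nat.twoStepInduction with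
  | zero => simp [gegenPoly]
  | one =>
    have := generating_deriv_eq l x 0 (by simp)
    simp at this
    simp [gegenPoly, this]
  | more k h0 h1 =>
    have h := generating_iteratedDeriv_rec l x k 0 (by simp)
    rw [h0, h1] at h
    have hr := gegenPoly_rec l k x
    rw [Nat.factorial_succ (k + 1)]
    rw [Nat.factorial_succ k] at h ⊢
    push_cast at h ⊢
    linear_combination h - ((k + 1) * k.factorial : ℝ) * hr

theorem gegenbauer_eq_eval (l x : ℝ) (hl : l ≠ 0) (k : ℕ) :
    gegenbauer l k x = (gegenPoly l k).eval x := by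
  rw [gegenbauer, if_neg hl, iteratedDeriv_generating_zero]
  have : (k.factorial : ℝ) ≠ 0 := by positivity
  field_simp

/-! ### Values, differential equation and minimisers of Gegenbauer polynomials -/

theorem gegenPoly_eval_neg (l x : ℝ) (k : ℕ) :
    (gegenPoly l k).eval (-x) = (-1) ^ k * (gegenPoly l k).eval x := by
  induction k using Nat.twoStepInduction with
  | zero => simp [gegenPoly]
  | one => simp [gegenPoly]
  | more k h0 h1 =>
    have ha := gegenPoly_rec l k x
    have hb := gegenPoly_rec l k (-x)
    rw [h0, h1] at hb
    have : (k : ℝ) + 2 ≠ 0 := by positivity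
    apply mul_left_cancel₀ this
    rw [hb]
    linear_combination -(-1 : ℝ) ^ k * ha

theorem gegenPoly_eval_one_succ (l : ℝ) (k : ℕ) :
    (k + 1) * (gegenPoly l (k + 1)).eval 1 = (k + 2 * l) * (gegenPoly l k).eval 1 := by
  induction k with
  | zero => simp [gegenPoly]
  | succ k ih =>
    have h := gegenPoly_rec l k 1
    push_cast
    linear_combination h + ih

theorem gegenPoly_eval_one_pos (l : ℝ) (hl : 0 < l) (k : ℕ) : 0 < (gegenPoly l k).eval 1 := by
  induction k with
  | zero => simp [gegenPoly]
  | succ k ih =>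
    have h := gegenPoly_eval_one_succ l k
    have : 0 < ((k : ℝ) + 1) * (gegenPoly l (k + 1)).eval 1 := by rw [h]; positivity
    exact pos_of_mul_pos_right this (by positivity)

open Polynomial in
/-- First-order differential relations between consecutive Gegenbauer polynomials. -/
theorem gegenPoly_derivative_rel (l x : ℝ) (k : ℕ) :
    (1 - x ^ 2) * (derivative (gegenPoly l (k + 1))).eval x =
        (k + 2 * l) * (gegenPoly l k).eval x - (k + 1) * x * (gegenPoly l (k + 1)).eval x ∧
      (1 - x ^ 2) * (derivative (gegenPoly l k)).eval x =
        (k + 2 * l) * x * (gegenPoly l k).eval x - (k + 1) * (gegenPoly l (k + 1)).eval x := by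
  induction k with
  | zero =>
    simp [gegenPoly]
    ring
  | succ k ih =>
    have hr := gegenPoly_rec l k x
    refine ⟨?_, ?_⟩
    · have hd : ((k : ℝ) + 2) * (derivative (gegenPoly l (k + 2))).eval x =
          2 * (k + 1 + l) * ((gegenPoly l (k + 1)).eval x +
            x * (derivative (gegenPoly l (k + 1))).eval x) -
            (k + 2 * l) * (derivative (gegenPoly l k)).eval x := by
        have : (k : ℝ) + 2 ≠ 0 := by positivity
        simp only [gegenPoly, derivative_mul, derivative_C, derivative_sub, derivative_X,
          eval_mul, eval_sub, eval_add, eval_C, eval_X, zero_mul, zero_add, eval_one]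
        field_simp
      have : (k : ℝ) + 2 ≠ 0 := by positivity
      apply mul_left_cancel₀ this
      push_cast
      linear_combination (1 - x ^ 2) * hd + 2 * (k + 1 + l) * x * ih.1 - (k + 2 * l) * ih.2 +
        (k + 2) * x * hr
    · push_cast
      linear_combination ih.1 + hr

open Polynomial in
theorem gegenPoly_ode (l x : ℝ) (hx : x ^ 2 ≠ 1) (k : ℕ) :
    (1 - x ^ 2) * (derivative (derivative (gegenPoly l (k + 1)))).eval x -
        (2 * l + 1) * x * (derivative (gegenPoly l (k + 1))).eval x +
        (k + 1) * (k + 1 + 2 * l) * (gegenPoly l (k + 1)).eval x = 0 := by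
  -- The first-order relation is lifted to an identity of polynomials so that it can be
  -- differentiated.
  have hpoly : (1 - X ^ 2) * derivative (gegenPoly l (k + 1)) =
      C (k + 2 * l) * gegenPoly l k - C ((k : ℝ) + 1) * (X * gegenPoly l (k + 1)) := by
    refine Polynomial.funext fun x => ?_
    have := (gegenPoly_derivative_rel l x k).1
    simp only [eval_mul, eval_sub, eval_one, eval_pow, eval_X, eval_C]
    linear_combination this
  have h := congrArg (fun p => (derivative p).eval x) hpoly
  simp only [derivative_mul, derivative_sub, derivative_one, derivative_X_pow, derivative_C,
    derivative_X, eval_mul, eval_sub, eval_add, eval_one, eval_pow, eval_X, eval_C, eval_zero,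
    zero_mul, zero_add] at h
  have h1 := (gegenPoly_derivative_rel l x k).1
  have h2 := (gegenPoly_derivative_rel l x k).2
  have hx' : 1 - x ^ 2 ≠ 0 := fun h => hx (by linarith)
  apply mul_left_cancel₀ hx'
  norm_num at h
  linear_combination (1 - x ^ 2) * h + (k + 2 * l) * h2 - (k + 2 * l) * x * h1

open Polynomial in
/-- The derivative of Sonin's function of a Gegenbauer polynomial. -/
theorem gegenPoly_sonin (l x : ℝ) (hx : x ^ 2 ≠ 1) (k : ℕ) :
    (derivative (C (((k : ℝ) + 1) * (k + 1 + 2 * l)) * gegenPoly l (k + 1) ^ 2 +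
      (1 - X ^ 2) * derivative (gegenPoly l (k + 1)) ^ 2)).eval x =
        4 * l * x * (derivative (gegenPoly l (k + 1))).eval x ^ 2 := by
  have h := gegenPoly_ode l x hx k
  simp only [derivative_mul, derivative_add, derivative_sub, derivative_one,
    derivative_C, derivative_pow, derivative_X, eval_mul, eval_sub, eval_add, eval_one, eval_pow,
    eval_X, eval_C, eval_zero, zero_mul, zero_add]
  norm_num
  linear_combination 2 * (derivative (gegenPoly l (k + 1))).eval x * h

open Polynomial in
-- At interior minimisers P' = 0, so Sonin's function takes the same value at both. Its derivative
-- 4lxP'² is nonnegative between them, so it is constant there, and P' vanishes on an interval. Then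
-- P is constant, zero by the differential equation, against P(1) > 0.
theorem gegenPoly_minimizer_not_lt (l : ℝ) (hl : 0 < l) (k : ℕ) (m : ℝ)
    (hm : ∀ x ∈ Set.Icc (-1 : ℝ) 1, m ≤ (gegenPoly l (k + 1)).eval x) {x y : ℝ} (hx0 : 0 ≤ x)
    (hy : y < 1) (hxm : (gegenPoly l (k + 1)).eval x = m)
    (hym : (gegenPoly l (k + 1)).eval y = m) : ¬ x < y := by
  intro hxy
  set P := gegenPoly l (k + 1) with hP
  have hcrit : ∀ z, -1 < z → z < 1 → P.eval z = m → (derivative P).eval z = 0 := by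
    intro z hz1 hz2 hz
    have : IsLocalMin (fun z => P.eval z) z := by
      filter_upwards [Icc_mem_nhds hz1 hz2] with w hw
      rw [hz]
      exact hm w hw
    exact this.hasDerivAt_eq_zero (P.hasDerivAt z)
  have hdx := hcrit x (by linarith) (by linarith) hxm
  have hdy := hcrit y (by linarith) hy hym
  set H := C (((k : ℝ) + 1) * (k + 1 + 2 * l)) * P ^ 2 + (1 - X ^ 2) * derivative P ^ 2 with hH
  have hsq : ∀ z ∈ Set.Ioo x y, z ^ 2 ≠ 1 := fun z hz h => by nlinarith [hz.1, hz.2]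
  have hder : ∀ z ∈ Set.Ioo x y, (derivative H).eval z = 4 * l * z * (derivative P).eval z ^ 2 :=
    fun z hz => gegenPoly_sonin l z (hsq z hz) k
  have hmono : MonotoneOn (fun z => H.eval z) (Set.Icc x y) := by
    apply monotoneOn_of_deriv_nonneg (convex_Icc x y) H.continuous.continuousOn
      H.differentiable.differentiableOn
    intro z hz
    rw [interior_Icc] at hz
    rw [Polynomial.deriv, hder z hz]
    have : 0 < z := by linarith [hz.1]
    positivity
  have hHxy : H.eval x = H.eval y := by simp [hH, hdx, hdy, hxm, hym]
  have hconst : ∀ z ∈ Set.Icc x y, H.eval z = H.eval x := fun z hz =>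
    le_antisymm ((hmono hz ⟨hxy.le, le_rfl⟩ hz.2).trans hHxy.ge)
      (hmono ⟨le_rfl, hxy.le⟩ hz hz.1)
  have hzero : ∀ z ∈ Set.Ioo x y, (derivative P).eval z = 0 := by
    intro z hz
    have h1 : (derivative H).eval z = 0 := by
      have h2 : HasDerivAt (fun _ : ℝ => H.eval x) ((derivative H).eval z) z :=
        (H.hasDerivAt z).congr_of_eventuallyEq (Filter.eventuallyEq_of_mem
          (Icc_mem_nhds hz.1 hz.2) fun w hw => (hconst w hw).symm)
      exact h2.unique (hasDerivAt_const z _)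
    rw [hder z hz] at h1
    have : 0 < z := by linarith [hz.1]
    simpa [hl.ne', this.ne'] using h1
  have hP' : derivative P = 0 :=
    Polynomial.eq_zero_of_infinite_isRoot _ ((Set.Ioo_infinite hxy).mono hzero)
  obtain ⟨z, hz⟩ := exists_between hxy
  have hode := gegenPoly_ode l z (hsq z hz) k
  rw [← hP, hP'] at hode
  have hPz : P.eval z = 0 := by
    have h1 : (k : ℝ) + 1 + 2 * l ≠ 0 := by positivity
    have h2 : (k : ℝ) + 1 ≠ 0 := by positivity
    simpa [h1, h2] using hode
  have hC := Polynomial.eq_C_of_derivative_eq_zero hP'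
  have h1 := gegenPoly_eval_one_pos l hl (k + 1)
  rw [← hP, hC, eval_C] at h1
  rw [hC, eval_C] at hPz
  exact h1.ne' hPz

/-- A negative minimum on `[-1, 1]` of a Gegenbauer polynomial of even degree is attained only at
two opposite points. -/
theorem gegenPoly_minimizer_abs_eq (l : ℝ) (hl : 0 < l) {t : ℕ} (ht : Even t) (ht0 : 0 < t)
    (m : ℝ) (hm0 : m < 0) (hm : ∀ x ∈ Set.Icc (-1 : ℝ) 1, m ≤ (gegenPoly l t).eval x) {x y : ℝ}
    (hx : x ∈ Set.Icc (-1 : ℝ) 1) (hy : y ∈ Set.Icc (-1 : ℝ) 1)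
    (hxm : (gegenPoly l t).eval x = m) (hym : (gegenPoly l t).eval y = m) : |x| = |y| := by
  have habs : ∀ z, (gegenPoly l t).eval |z| = (gegenPoly l t).eval z := fun z => by
    rcases abs_choice z with h | h <;> rw [h]
    rw [gegenPoly_eval_neg, ht.neg_one_pow, one_mul]
  obtain ⟨k, rfl⟩ := Nat.exists_eq_succ_of_ne_zero ht0.ne'
  -- The endpoints are not minimisers, since P(±1) > 0 > m.
  have hlt : ∀ z ∈ Set.Icc (-1 : ℝ) 1, (gegenPoly l (k + 1)).eval z = m → |z| < 1 := by
    intro z hz hzm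
    refine lt_of_le_of_ne (abs_le.2 hz) fun h => ?_
    have := gegenPoly_eval_one_pos l hl (k + 1)
    rw [← habs, h] at hzm
    linarith
  rw [← habs] at hxm hym
  have hx1 := hlt x hx (by rw [← habs]; exact hxm)
  have hy1 := hlt y hy (by rw [← habs]; exact hym)
  exact le_antisymm
    (not_lt.1 (gegenPoly_minimizer_not_lt l hl k m hm (abs_nonneg y) hx1 hym hxm))
    (not_lt.1 (gegenPoly_minimizer_not_lt l hl k m hm (abs_nonneg x) hy1 hxm hym))

/-! ### Designs with a single inner product -/

/-- A design of even index spans the space. -/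
theorem IsDesign.span_eq_top {n t : ℕ} {X : Finset (EuclideanSpace ℝ (Fin n))}
    (hX : IsDesign n t X) (ht : Even t) :
    Submodule.span ℝ (X : Set (EuclideanSpace ℝ (Fin n))) = ⊤ := by
  by_contra hne
  have hperp : (Submodule.span ℝ (X : Set (EuclideanSpace ℝ (Fin n))))ᗮ ≠ ⊥ := fun h =>
    hne (Submodule.orthogonal_eq_bot_iff.1 h)
  obtain ⟨v, hv, hv0⟩ := Submodule.exists_mem_ne_zero_of_ne_bot hperp
  have hvX : ∀ x ∈ X, inner ℝ x v = 0 := fun x hx =>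
    Submodule.inner_right_of_mem_orthogonal (Submodule.subset_span hx) hv
  obtain ⟨x₀, hx₀⟩ := hX.1
  have hn : ‖v‖ ≠ 0 := norm_ne_zero_iff.2 hv0
  -- The imaginary part of this isotropic form vanishes on X, so the sum of the even powers ⟨x,x₀⟩^t
  -- is zero although the term x = x₀ is 1.
  have h := hX.sum_isotropic_pow x₀ (‖v‖⁻¹ • v)
    (by rw [hX.2.1 x₀ hx₀, norm_smul, norm_inv, norm_norm, inv_mul_cancel₀ hn])
    (by rw [inner_smul_right, hvX x₀ hx₀, mul_zero])
  have h' : ∑ x ∈ X, (inner ℝ x x₀ : ℝ) ^ t = 0 := by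
    rw [← Complex.ofReal_inj, Complex.ofReal_zero, ← h]
    push_cast
    refine Finset.sum_congr rfl fun x hx => ?_
    simp [inner_smul_right, hvX x hx]
  have h2 := (Finset.sum_eq_zero_iff_of_nonneg fun x _ => ht.pow_nonneg _).1 h' x₀ hx₀
  rw [real_inner_self_eq_norm_sq, hX.2.1 x₀ hx₀] at h2
  simp at h2

/-- Sums of powers for a design all of whose inner products are equal. -/
theorem IsDesign.sum_pow_of_inner_eq {n t : ℕ} {X : Finset (EuclideanSpace ℝ (Fin n))}
    (hX : IsDesign n t X) (β : ℝ) (hβ : ∀ x ∈ X, ∀ y ∈ X, x ≠ y → inner ℝ x y = β)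
    (e : EuclideanSpace ℝ (Fin n) → ℂ)
    (he : (1 - β) * ∑ x ∈ X, e x ^ 2 + β * (∑ x ∈ X, e x) ^ 2 = 0) :
    ∑ x ∈ X, ((1 - β) * e x + β * ∑ y ∈ X, e y) ^ t = 0 := by
  classical
  have hin : ∀ (f : EuclideanSpace ℝ (Fin n) → ℝ), ∀ x ∈ X,
      inner ℝ x (∑ y ∈ X, f y • y) = (1 - β) * f x + β * ∑ y ∈ X, f y := by
    intro f x hx
    rw [inner_sum, ← Finset.add_sum_erase X _ hx, ← Finset.add_sum_erase X f hx,
      inner_smul_right, real_inner_self_eq_norm_sq, hX.2.1 x hx, mul_add, Finset.mul_sum,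
      Finset.sum_congr rfl fun y hy => by
        rw [inner_smul_right, hβ x hx y (Finset.mem_of_mem_erase hy)
          (Finset.ne_of_mem_erase hy).symm, mul_comm]]
    ring
  have hin2 : ∀ (f g : EuclideanSpace ℝ (Fin n) → ℝ),
      inner ℝ (∑ y ∈ X, f y • y) (∑ y ∈ X, g y • y) =
        (1 - β) * ∑ x ∈ X, f x * g x + β * ((∑ x ∈ X, f x) * ∑ x ∈ X, g x) := by
    intro f g
    rw [sum_inner, Finset.sum_congr rfl fun x hx => by
      rw [real_inner_smul_left, hin g x hx]]
    have : ∀ x, f x * ((1 - β) * g x + β * ∑ y ∈ X, g y) =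
      (1 - β) * (f x * g x) + β * (f x * ∑ y ∈ X, g y) := fun x => by ring
    simp only [this, Finset.sum_add_distrib, ← Finset.mul_sum, ← Finset.sum_mul]
  have hre := congrArg Complex.re he
  have him := congrArg Complex.im he
  simp only [← Complex.ofReal_one, ← Complex.ofReal_sub, Complex.add_re, Complex.add_im,
    Complex.ofReal_re, Complex.ofReal_im, zero_mul, sub_zero, add_zero, Complex.re_sum, Complex.im_sum, pow_two,
    Complex.mul_re, Complex.mul_im, Complex.zero_re, Complex.zero_im, Finset.sum_sub_distrib,
    Finset.sum_add_distrib] at hre him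
  -- Hypothesis `he` says that the complex vector ∑ e_y y has zero square under the bilinear inner
  -- product: its real and imaginary parts have equal norm and are orthogonal.
  have h := hX.sum_isotropic_pow (∑ y ∈ X, (e y).re • y) (∑ y ∈ X, (e y).im • y)
    (by
      rw [← sq_eq_sq₀ (norm_nonneg _) (norm_nonneg _), ← real_inner_self_eq_norm_sq,
        ← real_inner_self_eq_norm_sq, hin2, hin2]
      linear_combination hre)
    (by
      rw [hin2]
      have hc : ∑ x ∈ X, (e x).im * (e x).re = ∑ x ∈ X, (e x).re * (e x).im :=
        Finset.sum_congr rfl fun x _ => mul_comm _ _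
      rw [hc] at him
      linear_combination him / 2)
  rw [← h]
  refine Finset.sum_congr rfl fun x hx => ?_
  rw [hin _ x hx, hin _ x hx]
  congr 1
  apply Complex.ext
  · simp [Complex.re_sum, ← Complex.ofReal_one, ← Complex.ofReal_sub]
  · simp [Complex.im_sum, ← Complex.ofReal_one, ← Complex.ofReal_sub]

theorem sum_three {ι M : Type*} [AddCommMonoid M] {X : Finset ι} [DecidableEq ι] {a b c : ι}
    (ha : a ∈ X) (hb : b ∈ X) (hc : c ∈ X) (hab : a ≠ b) (hac : a ≠ c) (hbc : b ≠ c) (f : ι → M)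
    (hf : ∀ x, x ≠ a → x ≠ b → x ≠ c → f x = 0) : ∑ x ∈ X, f x = f a + f b + f c := by
  have hs : ({a, b, c} : Finset ι) ⊆ X := by
    intro x hx
    simp only [Finset.mem_insert, Finset.mem_singleton] at hx
    rcases hx with rfl | rfl | rfl <;> assumption
  rw [← Finset.sum_subset hs, Finset.sum_insert, Finset.sum_insert, Finset.sum_singleton, add_assoc]
  · simpa using hbc
  · simp [hab, hac]
  · intro x _ hx
    simp only [Finset.mem_insert, Finset.mem_singleton, not_or] at hx
    exact hf x hx.1 hx.2.1 hx.2.2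

/-- With at least three points and nondegenerate Gram matrix, a power sum in three variables
vanishes on a quadric. -/
theorem IsDesign.three_pow_of_inner_eq {n t : ℕ} {X : Finset (EuclideanSpace ℝ (Fin n))}
    (hX : IsDesign n t X) (ht0 : 0 < t) (β : ℝ) (hβ1 : β ≠ 1)
    (hβ : ∀ x ∈ X, ∀ y ∈ X, x ≠ y → inner ℝ x y = β)
    (hD : 1 + ((X.card : ℝ) - 1) * β ≠ 0) (hcard : 3 ≤ X.card) (p q r : ℂ)
    (hpqr : p ^ 2 + q ^ 2 + r ^ 2 =
      ((β / (1 + ((X.card : ℝ) - 1) * β) : ℝ) : ℂ) * (p + q + r) ^ 2) :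
    p ^ t + q ^ t + r ^ t = 0 := by
  classical
  obtain ⟨a, ha, b, hb, d, hd, hab, had, hbd⟩ := Finset.two_lt_card.1 hcard
  set D : ℝ := 1 + ((X.card : ℝ) - 1) * β with hDdef
  let u : EuclideanSpace ℝ (Fin n) → ℂ := fun x =>
    if x = a then p else if x = b then q else if x = d then r else 0
  have hu : ∀ k, 0 < k → ∑ x ∈ X, u x ^ k = p ^ k + q ^ k + r ^ k := by
    intro k hk
    rw [sum_three ha hb hd hab had hbd (fun x => u x ^ k)]
    · simp [u, hab.symm, had.symm, hbd.symm]
    · intro x h1 h2 h3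
      simp [u, h1, h2, h3, hk.ne']
  have hu1 : ∑ x ∈ X, u x = p + q + r := by simpa using hu 1 one_pos
  have hDc : (D : ℂ) ≠ 0 := by exact_mod_cast hD
  have hbc : (1 : ℂ) - β ≠ 0 := by
    rw [sub_ne_zero]; exact_mod_cast hβ1.symm
  have hDe : (D : ℂ) = 1 + ((X.card : ℂ) - 1) * β := by rw [hDdef]; push_cast; ring
  -- The inverse of the Gram matrix (1-β)I + βJ applied to u; hence u can be prescribed freely,
  -- subject only to the quadric.
  let e : EuclideanSpace ℝ (Fin n) → ℂ := fun x => (u x - β / D * (p + q + r)) / (1 - β)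
  have hS : ∑ x ∈ X, e x = (p + q + r) / D := by
    simp only [e, ← Finset.sum_div, Finset.sum_sub_distrib, hu1, Finset.sum_const, nsmul_eq_mul]
    field_simp
    rw [hDe]
    ring
  have hlin : ∀ x, (1 - β) * e x + β * ((p + q + r) / D) = u x := by
    intro x
    simp only [e]
    field_simp
    ring
  have hq : (1 - β) * ∑ x ∈ X, e x ^ 2 + β * (∑ x ∈ X, e x) ^ 2 = 0 := by
    have h1 : (1 - β) * ∑ x ∈ X, e x ^ 2 + β * (∑ x ∈ X, e x) ^ 2 = ∑ x ∈ X, e x * u x := by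
      rw [pow_two (∑ x ∈ X, e x), Finset.mul_sum, ← mul_assoc, Finset.mul_sum,
        ← Finset.sum_add_distrib]
      refine Finset.sum_congr rfl fun x _ => ?_
      rw [hS, ← hlin x]
      ring
    have h2 : ∑ x ∈ X, e x * u x =
        (∑ x ∈ X, u x ^ 2 - β / D * (p + q + r) * ∑ x ∈ X, u x) / (1 - β) := by
      rw [Finset.mul_sum, ← Finset.sum_sub_distrib, Finset.sum_div]
      exact Finset.sum_congr rfl fun x _ => by simp only [e]; ring
    rw [h1, h2, hu 2 two_pos, hu1, hpqr]
    push_cast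
    ring
  have h := hX.sum_pow_of_inner_eq β hβ e hq
  rw [hS] at h
  simp only [hlin] at h
  rw [← hu t ht0, h]

/-- If the power sum vanished on the whole quadric, then p^t = -2 at every point with q^t = r^t = 1.
For κ ≠ 1, the points (s,1,-1) give s² = -2/(1-κ), while those of the form (p,1,1) have two values
of p with product (2-4κ)/(1-κ). Both quantities have t-th power 4, so |2-4κ| = 2, which leaves only
κ = 0 or 1. -/
theorem exists_three_pow_ne_zero (κ : ℝ) (hκ : κ ≠ 0) {t : ℕ} (ht : Even t) (ht0 : 0 < t) :
    ∃ p q r : ℂ, p ^ 2 + q ^ 2 + r ^ 2 = κ * (p + q + r) ^ 2 ∧ p ^ t + q ^ t + r ^ t ≠ 0 := by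
  by_contra! H
  by_cases h1 : κ = 1
  · have h := H (((-1 / 2 : ℝ)) : ℂ) 1 1 (by rw [h1]; push_cast; norm_num)
    rw [one_pow] at h
    have h' : (-1 / 2 : ℝ) ^ t + 1 + 1 = 0 := by exact_mod_cast h
    linarith [ht.pow_nonneg (-1 / 2 : ℝ)]
  have hκ1 : 1 - (κ : ℂ) ≠ 0 := by
    rw [sub_ne_zero]; exact_mod_cast Ne.symm h1
  have key : ∀ p q r : ℂ, p ^ 2 + q ^ 2 + r ^ 2 = κ * (p + q + r) ^ 2 → q ^ t = 1 → r ^ t = 1 →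
      p ^ t = -2 := fun p q r h hq hr => by
    have := H p q r h
    rw [hq, hr] at this
    linear_combination this
  obtain ⟨s, hs⟩ := IsAlgClosed.exists_pow_nat_eq (-2 / (1 - (κ : ℂ))) two_pos
  have e1 : s ^ t = -2 := key s 1 (-1) (by
    rw [eq_div_iff hκ1] at hs; linear_combination hs) (one_pow t) ht.neg_one_pow
  obtain ⟨d, hd⟩ := IsAlgClosed.exists_pow_nat_eq (4 * κ ^ 2 - (1 - (κ : ℂ)) * (2 - 4 * κ)) two_pos
  have e2 : ((2 * κ + d) / (1 - (κ : ℂ))) ^ t = -2 := key _ 1 1 (by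
    field_simp; linear_combination (1 - (κ : ℂ)) * hd) (one_pow t) (one_pow t)
  have e3 : ((2 * κ - d) / (1 - (κ : ℂ))) ^ t = -2 := key _ 1 1 (by
    field_simp; linear_combination (1 - (κ : ℂ)) * hd) (one_pow t) (one_pow t)
  have e4 : ((2 - 4 * κ) / (1 - (κ : ℂ))) ^ t = (-2 / (1 - (κ : ℂ))) ^ t := by
    have ha : (2 - 4 * κ) / (1 - (κ : ℂ)) =
        (2 * κ + d) / (1 - (κ : ℂ)) * ((2 * κ - d) / (1 - (κ : ℂ))) := by
      field_simp; linear_combination hd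
    rw [ha, mul_pow, e2, e3, ← hs, ← pow_mul, mul_comm 2 t, pow_mul, e1]
    norm_num
  rw [div_pow, div_pow, div_left_inj' (pow_ne_zero t hκ1)] at e4
  have e5 : (2 - 4 * κ) ^ t = (-2 : ℝ) ^ t := by exact_mod_cast e4
  rw [← ht.pow_abs, ← ht.pow_abs (-2),
    pow_left_inj₀ (abs_nonneg _) (abs_nonneg _) ht0.ne'] at e5
  rcases abs_eq_abs.1 e5 with h | h
  · exact h1 (by linarith)
  · exact hκ (by linarith)

/-- For the roots of `z⁴ - z - 1` the first two power sums vanish, and the even ones from the fourth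
on do not. -/
theorem exists_four_pow_ne_zero {t : ℕ} (ht : Even t) (ht4 : 4 ≤ t) :
    ∃ a b c d : ℂ, a + b + c + d = 0 ∧ a ^ 2 + b ^ 2 + c ^ 2 + d ^ 2 = 0 ∧
      a ^ t + b ^ t + c ^ t + d ^ t ≠ 0 := by
  have hdeg : (Polynomial.X ^ 4 - Polynomial.X - 1 : Polynomial ℂ).natDegree = 4 := by
    compute_degree!
  have hmonic : (Polynomial.X ^ 4 - Polynomial.X - 1 : Polynomial ℂ).Monic := by
    monicity!
  have hsplit := IsAlgClosed.splits (Polynomial.X ^ 4 - Polynomial.X - 1 : Polynomial ℂ)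
  have hcard := hsplit.natDegree_eq_card_roots
  rw [hdeg] at hcard
  obtain ⟨a, b, c, d, hr⟩ := Multiset.card_eq_four.1 hcard.symm
  have hprod := hsplit.eq_prod_roots_of_monic hmonic
  rw [hr] at hprod
  have hev : ∀ z : ℂ, z ^ 4 - z - 1 = (z - a) * (z - b) * (z - c) * (z - d) := fun z => by
    have := congrArg (Polynomial.eval z) hprod
    simpa [mul_assoc] using this
  have h0 := hev 0
  have h1 := hev 1
  have h1' := hev (-1)
  have h2 := hev 2
  -- Finite differences of the factorisation at -1, 0, 1, 2 isolate its coefficients: the third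
  -- difference gives the cubic one, the second difference below the quadratic one.
  have s1 : a + b + c + d = 0 := by
    linear_combination (h2 - 3 * h1 + 3 * h0 - h1') / 6
  have s2 : a ^ 2 + b ^ 2 + c ^ 2 + d ^ 2 = 0 := by
    linear_combination (a + b + c + d) * s1 + (h1 + h1' - 2 * h0)
  refine ⟨a, b, c, d, s1, s2, ?_⟩
  have hrec : ∀ k, a ^ (k + 4) + b ^ (k + 4) + c ^ (k + 4) + d ^ (k + 4) =
      (a ^ (k + 1) + b ^ (k + 1) + c ^ (k + 1) + d ^ (k + 1)) +
        (a ^ k + b ^ k + c ^ k + d ^ k) := fun k => by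
    have ha := hev a
    have hb := hev b
    have hc := hev c
    have hd := hev d
    linear_combination a ^ k * ha + b ^ k * hb + c ^ k * hc + d ^ k * hd
  have s3 : a ^ 3 + b ^ 3 + c ^ 3 + d ^ 3 = 3 := by
    linear_combination ((a + b + c + d) ^ 2 -
      3 * (a * b + a * c + a * d + b * c + b * d + c * d) - 3) * s1 + 3 / 2 * (h1 - h1')
  have s4 : a ^ 4 + b ^ 4 + c ^ 4 + d ^ 4 = 4 := by
    have := hrec 0
    linear_combination this + s1
  -- The fifth power sum is 0, so positivity starts at the sixth. From there the recurrence p_{k+4}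
  -- = p_{k+1} + p_k preserves it, carrying four consecutive values.
  have hpos : ∀ k, ∃ m₀ m₁ m₂ m₃ : ℕ, 0 < m₀ ∧ 0 < m₁ ∧ 0 < m₂ ∧ 0 < m₃ ∧
      a ^ (k + 6) + b ^ (k + 6) + c ^ (k + 6) + d ^ (k + 6) = m₀ ∧
      a ^ (k + 7) + b ^ (k + 7) + c ^ (k + 7) + d ^ (k + 7) = m₁ ∧
      a ^ (k + 8) + b ^ (k + 8) + c ^ (k + 8) + d ^ (k + 8) = m₂ ∧
      a ^ (k + 9) + b ^ (k + 9) + c ^ (k + 9) + d ^ (k + 9) = m₃ := by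
    intro k
    induction k with
    | zero =>
      have r5 := hrec 1
      have r6 := hrec 2
      have r7 := hrec 3
      have r8 := hrec 4
      have r9 := hrec 5
      refine ⟨3, 7, 4, 3, by norm_num, by norm_num, by norm_num, by norm_num, ?_, ?_, ?_, ?_⟩ <;>
        push_cast
      · linear_combination r6 + s3 + s2
      · linear_combination r7 + s4 + s3
      · linear_combination r8 + r5 + s2 + s1 + s4
      · linear_combination r9 + r6 + s3 + s2 + r5 + s2 + s1
    | succ k ih =>
      obtain ⟨m₀, m₁, m₂, m₃, p0, p1, p2, p3, e0, e1, e2, e3⟩ := ih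
      refine ⟨m₁, m₂, m₃, m₁ + m₀, p1, p2, p3, by omega, ?_, ?_, ?_, ?_⟩
      · rw [← e1]
      · rw [← e2]
      · rw [← e3]
      · push_cast
        rw [← e0, ← e1]
        have := hrec (k + 6)
        linear_combination this
  rcases eq_or_lt_of_le ht4 with rfl | hlt
  · rw [s4]; norm_num
  · have : 6 ≤ t := by obtain ⟨s, rfl⟩ := ht; omega
    obtain ⟨k, rfl⟩ := Nat.exists_eq_add_of_le' this
    obtain ⟨m₀, -, -, -, p0, -, -, -, e0, -⟩ := hpos k
    rw [e0]
    exact_mod_cast p0.ne'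

theorem sum_four {ι M : Type*} [AddCommMonoid M] {X : Finset ι} [DecidableEq ι] {a b c d : ι}
    (ha : a ∈ X) (hb : b ∈ X) (hc : c ∈ X) (hd : d ∈ X) (hab : a ≠ b) (hac : a ≠ c) (had : a ≠ d)
    (hbc : b ≠ c) (hbd : b ≠ d) (hcd : c ≠ d) (f : ι → M)
    (hf : ∀ x, x ≠ a → x ≠ b → x ≠ c → x ≠ d → f x = 0) :
    ∑ x ∈ X, f x = f a + f b + f c + f d := by
  rw [← Finset.add_sum_erase X f ha, add_assoc, add_assoc, ← add_assoc (f b),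
    Finset.sum_congr rfl (g := fun x => if x = a then 0 else f x)
      fun x hx => (if_neg (Finset.ne_of_mem_erase hx)).symm,
    sum_three (Finset.mem_erase.2 ⟨hab.symm, hb⟩) (Finset.mem_erase.2 ⟨hac.symm, hc⟩)
      (Finset.mem_erase.2 ⟨had.symm, hd⟩) hbc hbd hcd]
  · simp [hab.symm, hac.symm, had.symm]
  · intro x h1 h2 h3
    by_cases h : x = a
    · simp [h]
    · simp [h, hf x h h1 h2 h3]

/-- In dimension at least three a design of even index is not a set with a single nonzero inner
product, apart possibly from a regular simplex when the index is two. -/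
theorem IsDesign.inner_not_const {n t : ℕ} {X : Finset (EuclideanSpace ℝ (Fin n))}
    (hX : IsDesign n t X) (hn : 3 ≤ n) (ht : Even t) (ht0 : 0 < t) (β : ℝ) (hβ0 : β ≠ 0)
    (ht4 : β < 0 → 4 ≤ t) (hβ : ∀ x ∈ X, ∀ y ∈ X, x ≠ y → inner ℝ x y = β) : False := by
  classical
  have hspan := hX.span_eq_top ht
  have hcard : n ≤ X.card := by
    have := finrank_span_finset_le_card (R := ℝ) X
    rwa [Set.finrank, hspan, finrank_top, finrank_euclideanSpace_fin] at this
  have hβ1 : β ≠ 1 := by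
    rintro rfl
    obtain ⟨x, hx, y, hy, hxy⟩ := Finset.one_lt_card.1 (by omega : 1 < X.card)
    exact hxy ((inner_eq_one_iff_of_norm_eq_one (hX.2.1 x hx) (hX.2.1 y hy)).1 (hβ x hx y hy hxy))
  by_cases hD : 1 + ((X.card : ℝ) - 1) * β = 0
  -- Singular Gram matrix: the points sum to zero, so any one of them is redundant for spanning and
  -- |X| ≥ n + 1 ≥ 4.
  · have hneg : β < 0 := by
      by_contra h
      have h3 : (3 : ℝ) ≤ X.card := by exact_mod_cast hn.trans hcard
      nlinarith
    have hsum0 : ∑ x ∈ X, x = 0 := by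
      rw [← inner_self_eq_zero (𝕜 := ℝ), sum_inner]
      refine Finset.sum_eq_zero fun x hx => ?_
      rw [inner_sum, ← Finset.add_sum_erase X _ hx, real_inner_self_eq_norm_sq, hX.2.1 x hx,
        Finset.sum_congr rfl fun y hy => hβ x hx y (Finset.mem_of_mem_erase hy)
          (Finset.ne_of_mem_erase hy).symm, Finset.sum_const, Finset.card_erase_of_mem hx,
        nsmul_eq_mul, Nat.cast_sub (by omega)]
      push_cast
      linarith
    have hcard4 : n + 1 ≤ X.card := by
      obtain ⟨x₀, hx₀⟩ := hX.1
      have h1 := finrank_span_finset_le_card (R := ℝ) (X.erase x₀)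
      have h2 : Submodule.span ℝ ((X.erase x₀ : Finset _) : Set (EuclideanSpace ℝ (Fin n))) = ⊤ := by
        rw [eq_top_iff, ← hspan, Submodule.span_le]
        intro x hx
        by_cases h : x = x₀
        · have hsum0 := hsum0
          rw [← Finset.add_sum_erase X _ hx₀] at hsum0
          have hm : -∑ y ∈ X.erase x₀, y ∈ Submodule.span ℝ
              ((X.erase x₀ : Finset _) : Set (EuclideanSpace ℝ (Fin n))) :=
            Submodule.neg_mem _ (Submodule.sum_mem _ fun y hy => Submodule.subset_span hy)
          rw [← eq_neg_of_add_eq_zero_left hsum0] at hm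
          rwa [h]
        · exact Submodule.subset_span (Finset.mem_erase.2 ⟨h, hx⟩)
      rw [Set.finrank, h2, finrank_top, finrank_euclideanSpace_fin,
        Finset.card_erase_of_mem hx₀] at h1
      omega
    obtain ⟨p, q, r, s, s1, s2, sne⟩ := exists_four_pow_ne_zero ht (ht4 hneg)
    obtain ⟨Y, hYX, hY⟩ := Finset.exists_subset_card_eq (show 4 ≤ X.card by omega)
    obtain ⟨a, b, c, d, hab, hac, had, hbc, hbd, hcd, rfl⟩ := Finset.card_eq_four.1 hY
    have ha : a ∈ X := hYX (by simp)
    have hb : b ∈ X := hYX (by simp)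
    have hc : c ∈ X := hYX (by simp)
    have hd : d ∈ X := hYX (by simp)
    let e : EuclideanSpace ℝ (Fin n) → ℂ := fun x =>
      if x = a then p else if x = b then q else if x = c then r else if x = d then s else 0
    have he : ∀ k, 0 < k → ∑ x ∈ X, e x ^ k = p ^ k + q ^ k + r ^ k + s ^ k := by
      intro k hk
      rw [sum_four ha hb hc hd hab hac had hbc hbd hcd (fun x => e x ^ k)]
      · simp [e, hab.symm, hac.symm, had.symm, hbc.symm, hbd.symm, hcd.symm]
      · intro x h1 h2 h3 h4
        simp [e, h1, h2, h3, h4, hk.ne']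
    have he1 : ∑ x ∈ X, e x = 0 := by simpa [s1] using he 1 one_pos
    -- As ∑ e = 0, isotropy reduces to ∑ e² = 0 and the form takes the value (1-β)e_x at x.
    have h := hX.sum_pow_of_inner_eq β hβ e (by rw [he 2 two_pos, he1, s2]; ring)
    simp only [he1, mul_zero, add_zero, mul_pow, ← Finset.mul_sum] at h
    rw [he t ht0] at h
    have hbc : (1 : ℂ) - β ≠ 0 := by
      rw [sub_ne_zero]; exact_mod_cast hβ1.symm
    exact (mul_ne_zero (pow_ne_zero t hbc) sne) h
  · obtain ⟨p, q, r, h1, h2⟩ := exists_three_pow_ne_zero _ (div_ne_zero hβ0 hD) ht ht0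
    exact h2 (hX.three_pow_of_inner_eq ht0 β hβ1 hβ hD (hn.trans hcard) p q r h1)

/-! ### Equality in the linear programming bound -/

theorem dimHarm_pos {n t : ℕ} (hn : 2 ≤ n) (ht : 2 ≤ t) : 0 < dimHarm n t := by
  obtain ⟨m, rfl⟩ := Nat.exists_eq_add_of_le' hn
  obtain ⟨s, rfl⟩ := Nat.exists_eq_add_of_le' ht
  rw [dimHarm, sub_pos, Nat.cast_lt, show m + 2 + (s + 2) - 3 = m + s + 1 by omega,
    show m + 2 + (s + 2) - 1 = m + s + 2 + 1 by omega, Nat.add_sub_cancel]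
  calc (m + s + 1).choose s ≤ (m + s + 2).choose (s + 1) := by
        rw [Nat.choose_succ_succ]; omega
    _ < (m + s + 2 + 1).choose (s + 2) := by
        rw [Nat.choose_succ_succ (m + s + 2)]
        exact Nat.lt_add_of_pos_right (Nat.choose_pos (by omega))

theorem inner_mem_Icc_of_norm_eq_one {E : Type*} [NormedAddCommGroup E] [InnerProductSpace ℝ E] {x y : E}
    (hx : ‖x‖ = 1) (hy : ‖y‖ = 1) : inner ℝ x y ∈ Set.Icc (-1 : ℝ) 1 := by
  have := abs_real_inner_le_norm x y
  rw [hx, hy, mul_one] at this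
  exact abs_le.1 this

theorem neg_c_le {n t : ℕ} (hc : Continuous (Q n t)) {x : ℝ} (hx : x ∈ Set.Icc (-1 : ℝ) 1) :
    -c n t ≤ Q n t x := by
  rw [c, neg_neg]
  exact csInf_le (isCompact_Icc.image hc).bddBelow ⟨x, hx, rfl⟩

/-- If Q were nonnegative on [-1,1], a vanishing sum would force its diagonal term Q(1) to vanish.
Positivity also ensures that 1/c in `b` is a genuine quotient. -/
theorem IsDesign.c_pos {n t : ℕ} {X : Finset (EuclideanSpace ℝ (Fin n))} (hX : IsDesign n t X)
    (hc : Continuous (Q n t)) (h1 : 0 < Q n t 1)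
    (hsum : ∀ y ∈ X, ∑ x ∈ X, Q n t (inner ℝ x y) = 0) : 0 < c n t := by
  by_contra! h
  obtain ⟨y, hy⟩ := hX.1
  have hnn : ∀ x ∈ X, 0 ≤ Q n t (inner ℝ x y) := fun x hx =>
    (neg_nonneg.2 h).trans (neg_c_le hc (inner_mem_Icc_of_norm_eq_one (hX.2.1 x hx) (hX.2.1 y hy)))
  have := (Finset.sum_eq_zero_iff_of_nonneg hnn).1 (hsum y hy) y hy
  rw [real_inner_self_eq_norm_sq, hX.2.1 y hy, one_pow] at this
  exact h1.ne' this

/-- In a design attaining the bound, all inner products of distinct points minimise `Q`. -/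
theorem IsDesign.Q_inner_eq {n t : ℕ} {X : Finset (EuclideanSpace ℝ (Fin n))}
    (hX : IsDesign n t X) (hcard : (X.card : ℝ) = b n t) (hc : Continuous (Q n t))
    (hd : 0 < dimHarm n t) (h1 : Q n t 1 = dimHarm n t)
    (hsum : ∀ y ∈ X, ∑ x ∈ X, Q n t (inner ℝ x y) = 0) :
    ∀ x ∈ X, ∀ y ∈ X, x ≠ y → Q n t (inner ℝ x y) = -c n t := by
  classical
  intro x hx y hy hxy
  have hcpos := hX.c_pos hc (h1 ▸ hd) hsum
  have hs := hsum y hy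
  rw [← Finset.add_sum_erase X _ hy, real_inner_self_eq_norm_sq, hX.2.1 y hy, one_pow, h1] at hs
  have hcast : (((X.erase y).card : ℕ) : ℝ) * c n t = dimHarm n t := by
    rw [Finset.card_erase_of_mem hy, Nat.cast_sub (Finset.card_pos.2 hX.1), hcard, b]
    field_simp
    push_cast
    ring
  have hzero : ∑ z ∈ X.erase y, (Q n t (inner ℝ z y) + c n t) = 0 := by
    rw [Finset.sum_add_distrib, Finset.sum_const, nsmul_eq_mul, hcast]
    linarith
  have hnn : ∀ z ∈ X.erase y, 0 ≤ Q n t (inner ℝ z y) + c n t := fun z hz => by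
    have := neg_c_le hc
      (inner_mem_Icc_of_norm_eq_one (hX.2.1 z (Finset.mem_of_mem_erase hz)) (hX.2.1 y hy))
    linarith
  have := (Finset.sum_eq_zero_iff_of_nonneg hnn).1 hzero x (Finset.mem_erase.2 ⟨hxy, hx⟩)
  linarith

/-! ### Equiangular lines -/

theorem min_arccos_pi_sub (z : ℝ) :
    min (Real.arccos z) (Real.pi - Real.arccos z) = Real.arccos |z| := by
  rw [← Real.arccos_neg]
  rcases le_total 0 z with h | h
  · rw [abs_of_nonneg h, min_eq_left (Real.antitone_arccos (by linarith))]
  · rw [abs_of_nonpos h, min_eq_right (Real.antitone_arccos (by linarith))]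

theorem isEquiangular_of_abs_inner_eq {n : ℕ} {X : Set (EuclideanSpace ℝ (Fin n))} (α : ℝ)
    (hX : ∀ x ∈ X, ‖x‖ = 1) (hα : ∀ x ∈ X, ∀ y ∈ X, x ≠ y → |inner ℝ x y| = α) :
    IsEquiangular (line '' X) := by
  constructor
  · rintro _ ⟨x, hx, rfl⟩
    refine finrank_span_singleton fun h => ?_
    simpa [h] using hX x hx
  · refine ⟨Real.arccos α, ?_⟩
    rintro _ ⟨x, hx, rfl⟩ _ ⟨y, hy, rfl⟩ hne u hu v hv hu0 hv0
    have hxy : x ≠ y := fun h => hne (by rw [h])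
    obtain ⟨r, rfl⟩ := Submodule.mem_span_singleton.1 hu
    obtain ⟨s, rfl⟩ := Submodule.mem_span_singleton.1 hv
    have hr : |r| ≠ 0 := abs_ne_zero.2 fun h => hu0 (by simp [h])
    have hs : |s| ≠ 0 := abs_ne_zero.2 fun h => hv0 (by simp [h])
    rw [InnerProductGeometry.angle, min_arccos_pi_sub, ← hα x hx y hy hxy]
    congr 1
    rw [real_inner_smul_left, real_inner_smul_right, norm_smul, norm_smul, hX x hx, hX y hy,
      abs_div, abs_mul, abs_mul, abs_mul, Real.norm_eq_abs, Real.norm_eq_abs]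
    simp only [mul_one, abs_abs]
    field_simp

theorem injOn_line_of_inner_ne {n : ℕ} {X : Set (EuclideanSpace ℝ (Fin n))}
    (hX : ∀ x ∈ X, ‖x‖ = 1) (h : ∀ x ∈ X, ∀ y ∈ X, x ≠ y → inner ℝ x y ≠ (-1 : ℝ)) :
    Set.InjOn line X := by
  intro x hx y hy hxy
  by_contra hne
  obtain ⟨r, hr⟩ := Submodule.mem_span_singleton.1
    (show y ∈ line x from hxy ▸ Submodule.mem_span_singleton_self y)
  have h1 : |r| = 1 := by
    have := congrArg norm hr
    rwa [norm_smul, hX x hx, hX y hy, mul_one] at this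
  rcases eq_or_eq_neg_of_abs_eq h1 with rfl | rfl
  · exact hne (by rw [← hr, one_smul])
  · apply h x hx y hy hne
    rw [← hr, inner_smul_right, real_inner_self_eq_norm_sq, hX x hx]
    norm_num

/-! ### The plane -/

theorem chebyshev_T_eval_eq_re_pow (x y : ℝ) (h : x ^ 2 + y ^ 2 = 1) (k : ℕ) :
    (Polynomial.Chebyshev.T ℝ (k : ℤ)).eval x = ((x + y * Complex.I : ℂ) ^ k).re := by
  induction k using Nat.twoStepInduction with
  | zero => simp
  | one => simp
  | more k h0 h1 =>
    have hz : (x + y * Complex.I : ℂ) ^ (k + 2) =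
        ((2 * x : ℝ) : ℂ) * (x + y * Complex.I) ^ (k + 1) - (x + y * Complex.I) ^ k := by
      have hc : (x : ℂ) ^ 2 + y ^ 2 = 1 := by exact_mod_cast h
      push_cast
      linear_combination (x + y * Complex.I : ℂ) ^ k * (y ^ 2 * Complex.I_sq - hc)
    rw [hz, Complex.sub_re, Complex.re_ofReal_mul, ← h0, ← h1]
    push_cast
    rw [Polynomial.Chebyshev.T_add_two]
    simp

theorem Q_two_eq (t : ℕ) (x : ℝ) :
    Q 2 t x = dimHarm 2 t * (Polynomial.Chebyshev.T ℝ (t : ℤ)).eval x := by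
  simp [Q, gegenbauer]

/-- At l = 0 the polynomials `gegenPoly` of positive degree vanish, so the zonal argument says
nothing here. Instead y and its rotation by a right angle form an isotropic pair, on which unit
vectors take values of modulus 1, and T_t is the real part of the t-th power. -/
theorem IsDesign.sum_chebyshev {t : ℕ} {X : Finset (EuclideanSpace ℝ (Fin 2))}
    (hX : IsDesign 2 t X) (y : EuclideanSpace ℝ (Fin 2)) (hy : ‖y‖ = 1) :
    ∑ x ∈ X, (Polynomial.Chebyshev.T ℝ (t : ℤ)).eval (inner ℝ x y) = 0 := by
  have hy2 : y 0 ^ 2 + y 1 ^ 2 = 1 := by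
    have := EuclideanSpace.norm_sq_eq y
    simpa [hy] using this.symm
  have h := hX.sum_isotropic_pow y !₂[-(y 1), y 0]
    (by rw [hy, EuclideanSpace.norm_eq]; simp [add_comm, hy2])
    (by simp [PiLp.inner_apply, Fin.sum_univ_two]; ring)
  have h2 := congrArg Complex.re h
  rw [Complex.re_sum, Complex.zero_re] at h2
  rw [← h2]
  refine Finset.sum_congr rfl fun x hx => chebyshev_T_eval_eq_re_pow _ _ ?_ t
  have hx2 : x 0 ^ 2 + x 1 ^ 2 = 1 := by
    have := EuclideanSpace.norm_sq_eq x
    simpa [hX.2.1 x hx] using this.symm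
  simp [PiLp.inner_apply, Fin.sum_univ_two]
  linear_combination hx2 + (x 0 ^ 2 + x 1 ^ 2) * hy2

/-- The minimum of T_t on [-1,1] is -1, attained at cos(π/t), so c equals the dimension factor. -/
theorem b_two_eq {t : ℕ} (ht : 2 ≤ t) : b 2 t = 2 := by
  have hd := dimHarm_pos le_rfl ht
  have hc : c 2 t = dimHarm 2 t := by
    rw [c, neg_eq_iff_eq_neg]
    apply IsLeast.csInf_eq
    constructor
    · refine ⟨Real.cos (Real.pi / t), ⟨Real.neg_one_le_cos _, Real.cos_le_one _⟩, ?_⟩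
      have : (t : ℝ) ≠ 0 := by positivity
      rw [Q_two_eq, Polynomial.Chebyshev.T_real_cos]
      push_cast
      rw [mul_div_cancel₀ _ this, Real.cos_pi]
      ring
    · rintro _ ⟨x, hx, rfl⟩
      have := (Polynomial.Chebyshev.eval_T_real_mem_Icc t hx).1
      rw [Q_two_eq]
      nlinarith
  rw [b, hc]
  field_simp
  norm_num

theorem tight_design_two {t : ℕ} (ht : Even t) (ht2 : 2 ≤ t)
    (X : Finset (EuclideanSpace ℝ (Fin 2))) (hX : IsDesign 2 t X)
    (hcard : (X.card : ℝ) = b 2 t) :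
    (∃ α ∈ Set.Icc (-1 : ℝ) 1, innerProducts X = {α}) ∧
      Set.InjOn line (X : Set (EuclideanSpace ℝ (Fin 2))) ∧
      IsEquiangular (line '' (X : Set (EuclideanSpace ℝ (Fin 2)))) := by
  have hd := dimHarm_pos le_rfl ht2
  have hQ : Q 2 t = fun x => dimHarm 2 t * (Polynomial.Chebyshev.T ℝ (t : ℤ)).eval x :=
    funext (Q_two_eq t)
  have hcont : Continuous (Q 2 t) := by rw [hQ]; fun_prop
  have h1 : Q 2 t 1 = dimHarm 2 t := by simp [Q_two_eq]
  have hneg : Q 2 t (-1) = dimHarm 2 t := by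
    rw [Q_two_eq, Polynomial.Chebyshev.T_eval_neg, Int.negOnePow_even _ (by exact_mod_cast ht)]
    simp
  have hsum : ∀ y ∈ X, ∑ x ∈ X, Q 2 t (inner ℝ x y) = 0 := fun y hy => by
    simp only [Q_two_eq, ← Finset.mul_sum, hX.sum_chebyshev y (hX.2.1 y hy), mul_zero]
  have hcpos := hX.c_pos hcont (h1 ▸ hd) hsum
  have hmin := hX.Q_inner_eq hcard hcont hd h1 hsum
  rw [b_two_eq ht2] at hcard
  obtain ⟨x, y, hxy, rfl⟩ := Finset.card_eq_two.1 (by exact_mod_cast hcard : X.card = 2)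
  have hall : ∀ u ∈ ({x, y} : Finset _), ∀ v ∈ ({x, y} : Finset _), u ≠ v →
      inner ℝ u v = inner ℝ x y := by
    intro u hu v hv huv
    simp only [Finset.mem_insert, Finset.mem_singleton] at hu hv
    rcases hu with rfl | rfl <;> rcases hv with rfl | rfl
    · exact absurd rfl huv
    · rfl
    · exact real_inner_comm _ _
    · exact absurd rfl huv
  refine ⟨⟨inner ℝ x y, inner_mem_Icc_of_norm_eq_one (hX.2.1 x (by simp)) (hX.2.1 y (by simp)), ?_⟩, ?_, ?_⟩
  · ext z
    constructor
    · rintro ⟨u, hu, v, hv, huv, rfl⟩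
      exact hall u hu v hv huv
    · rintro rfl
      exact ⟨x, by simp, y, by simp, hxy, rfl⟩
  -- Inner product -1 would give Q(-1) = Q(1) > 0, against the minimum -c < 0.
  · refine injOn_line_of_inner_ne hX.2.1 fun u hu v hv huv h => ?_
    have := hmin u hu v hv huv
    rw [h, hneg] at this
    linarith
  · exact isEquiangular_of_abs_inner_eq _ hX.2.1 fun u hu v hv huv =>
      congrArg abs (hall u hu v hv huv)

/-! ### Dimension at least three -/

theorem tight_design_three_le {n t : ℕ} (hn : 3 ≤ n) (ht : Even t) (ht2 : 2 ≤ t)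
    (X : Finset (EuclideanSpace ℝ (Fin n))) (hX : IsDesign n t X)
    (hcard : (X.card : ℝ) = b n t) :
    (∃ α ∈ Set.Icc (-1 : ℝ) 1, innerProducts X = {α, -α}) ∧
      Set.InjOn line (X : Set (EuclideanSpace ℝ (Fin n))) ∧
      IsEquiangular (line '' (X : Set (EuclideanSpace ℝ (Fin n)))) := by
  have hd := dimHarm_pos (by omega : 2 ≤ n) ht2
  obtain ⟨l, hl⟩ : ∃ l : ℝ, l = ((n : ℝ) - 2) / 2 := ⟨_, rfl⟩
  have hl0 : 0 < l := by
    have : (3 : ℝ) ≤ n := by exact_mod_cast hn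
    rw [hl]; linarith
  have hP1 := gegenPoly_eval_one_pos l hl0 t
  obtain ⟨K, hK⟩ : ∃ K : ℝ, K = dimHarm n t / (gegenPoly l t).eval 1 := ⟨_, rfl⟩
  have hK0 : 0 < K := by rw [hK]; positivity
  have hQ : Q n t = fun x => K * (gegenPoly l t).eval x := by
    funext x
    rw [Q, ← hl, gegenbauer_eq_eval l _ hl0.ne', gegenbauer_eq_eval l _ hl0.ne', hK]
  have hcont : Continuous (Q n t) := by rw [hQ]; fun_prop
  have h1 : Q n t 1 = dimHarm n t := by rw [hQ, hK]; field_simp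
  have hneg : Q n t (-1) = dimHarm n t := by
    rw [← h1, hQ]
    simp only [gegenPoly_eval_neg, ht.neg_one_pow, one_mul]
  have hsum : ∀ y ∈ X, ∑ x ∈ X, Q n t (inner ℝ x y) = 0 := fun y hy => by
    have := hX.sum_gegenPoly y (hX.2.1 y hy)
    rw [← hl] at this
    simp only [hQ, ← Finset.mul_sum, this, mul_zero]
  have hcpos := hX.c_pos hcont (h1 ▸ hd) hsum
  have hmin := hX.Q_inner_eq hcard hcont hd h1 hsum
  have hPmin : ∀ z ∈ Set.Icc (-1 : ℝ) 1, -c n t / K ≤ (gegenPoly l t).eval z := fun z hz => by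
    have := neg_c_le hcont hz
    rw [hQ] at this
    rwa [div_le_iff₀' hK0]
  have hPeq : ∀ x ∈ X, ∀ y ∈ X, x ≠ y → (gegenPoly l t).eval (inner ℝ x y) = -c n t / K :=
    fun x hx y hy hxy => by
      have := hmin x hx y hy hxy
      rw [hQ] at this
      rwa [eq_div_iff hK0.ne', mul_comm]
  have hcard1 : 1 < X.card := by
    have : (1 : ℝ) < X.card := by
      rw [hcard, b, lt_add_iff_pos_right]
      positivity
    exact_mod_cast this
  obtain ⟨x₀, hx₀, y₀, hy₀, hxy₀⟩ := Finset.one_lt_card.1 hcard1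
  obtain ⟨α, hα⟩ : ∃ α : ℝ, α = inner ℝ x₀ y₀ := ⟨_, rfl⟩
  have hα1 : α ∈ Set.Icc (-1 : ℝ) 1 := hα ▸ inner_mem_Icc_of_norm_eq_one (hX.2.1 x₀ hx₀) (hX.2.1 y₀ hy₀)
  have habs : ∀ x ∈ X, ∀ y ∈ X, x ≠ y → |inner ℝ x y| = |α| := fun x hx y hy hxy =>
    gegenPoly_minimizer_abs_eq l hl0 ht (by omega) _ (div_neg_of_neg_of_pos (by linarith) hK0)
      hPmin (inner_mem_Icc_of_norm_eq_one (hX.2.1 x hx) (hX.2.1 y hy)) hα1 (hPeq x hx y hy hxy)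
      (hα ▸ hPeq x₀ hx₀ y₀ hy₀ hxy₀)
  refine ⟨⟨α, hα1, ?_⟩, ?_, isEquiangular_of_abs_inner_eq _ hX.2.1 habs⟩
  · have hmemα : α ∈ innerProducts X := ⟨x₀, hx₀, y₀, hy₀, hxy₀, hα.symm⟩
    ext z
    constructor
    · rintro ⟨x, hx, y, hy, hxy, rfl⟩
      exact abs_eq_abs.1 (habs x hx y hy hxy)
    · rintro (rfl | rfl)
      · exact hmemα
      -- If -α is missing, then α ≠ 0 is the only inner product, which `IsDesign.inner_not_const`
      -- excludes.
      · by_contra hnot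
        have hα0 : α ≠ 0 := by
          rintro rfl
          rw [neg_zero] at hnot
          exact hnot hmemα
        refine hX.inner_not_const hn ht (by omega) α hα0 (fun _ => ?_) fun x hx y hy hxy => ?_
        · by_contra hlt
          obtain rfl : t = 2 := by obtain ⟨s, rfl⟩ := ht; omega
          -- For t = 2 the polynomial is 2l(l+1)x² - l, whose only minimiser is 0, contradicting α ≠
          -- 0.
          have e1 := hPmin 0 (by norm_num)
          have e2 := hPeq x₀ hx₀ y₀ hy₀ hxy₀
          rw [← hα] at e2
          rw [← e2] at e1
          simp [gegenPoly] at e1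
          have : 0 < α ^ 2 := by positivity
          nlinarith [mul_pos hl0 this, mul_pos hl0 (mul_pos hl0 this)]
        · refine (abs_eq_abs.1 (habs x hx y hy hxy)).resolve_right fun h => hnot ?_
          exact ⟨x, hx, y, hy, hxy, h⟩
  · refine injOn_line_of_inner_ne hX.2.1 fun u hu v hv huv h => ?_
    have := hmin u hu v hv huv
    rw [h, hneg] at this
    linarith

end HarmonicIndex

theorem mainTheorem6 (n t : ℕ) (hn : 2 ≤ n) (ht : Even t) (ht0 : 0 < t)
    (hb : ∃ k : ℕ, HarmonicIndex.b n t = (k : ℝ))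
    (X : Finset (EuclideanSpace ℝ (Fin n))) (hX : HarmonicIndex.IsDesign n t X)
    (hcard : (X.card : ℝ) = HarmonicIndex.b n t) :
    (∃ α ∈ Set.Icc (-1 : ℝ) 1,
      (3 ≤ n → HarmonicIndex.innerProducts X = {α, -α}) ∧
      (n = 2 → HarmonicIndex.innerProducts X = {α})) ∧
    Set.InjOn HarmonicIndex.line (X : Set (EuclideanSpace ℝ (Fin n))) ∧
    HarmonicIndex.IsEquiangular
      (HarmonicIndex.line '' (X : Set (EuclideanSpace ℝ (Fin n)))) := by
  have ht2 : 2 ≤ t := by obtain ⟨s, rfl⟩ := ht; omega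
  rcases eq_or_lt_of_le hn with rfl | h3
  · obtain ⟨⟨α, hα, h⟩, hinj, heq⟩ := HarmonicIndex.tight_design_two ht ht2 X hX hcard
    exact ⟨⟨α, hα, fun h => by omega, fun _ => h⟩, hinj, heq⟩
  · obtain ⟨⟨α, hα, h⟩, hinj, heq⟩ := HarmonicIndex.tight_design_three_le h3 ht ht2 X hX hcard
    exact ⟨⟨α, hα, fun _ => h, fun h => by omega⟩, hinj, heq⟩
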